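/- Let $\mathcal G$ be a finite simple undirected graph with vertex set $V$ and at least one edge. For $u\in V$ let $\mathbf 1_u$ denote the standard basis vector of $\mathbb R^V$, and let $$P_{\mathcal G}=\operatorname{conv}\{\mathbf 1_u-\mathbf 1_v,\ \mathbf 1_v-\mathbf 1_u \mid uv\in E(\mathcal G)\}\subset\mathbb R^V$$ be the symmetric edge polytope of $\mathcal G$. For a lattice polytope $P\subset\mathbb R^V$ of dimension $d$, the $h^*$-vector $(h^*_0,\dots,h^*_d)$ of $P$ is the unique vector of rational numbers with $$|tP\cap\mathbb Z^V|=\sum_{k=0}^d h^*_k\binom{t+d-k}{d}\qquad\text{for all } t\in\mathbb N,$$ and we set $h^*_k=0$ for $k>d$. An *oriented spanning tree* of $\mathcal G$ is a spanning tree $T$ of $\mathcal G$ together with a choice of a direction for each of its edges; let $\mathcal Q_T=\operatorname{conv}\{\mathbf 1_h-\mathbf 1_t\mid \overrightarrow{th}\in T\}$. A set $\mathcal T$ of oriented spanning trees is a *dissecting tree set* for $\mathcal G$ if the simplices $\mathcal Q_T$, $T\in\mathcal T$, have pairwise disjoint relative interiors and their union is the relative boundary of $P_{\mathcal G}$. (A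 dissecting tree set can exist only if $\mathcal G$ is connected.) Consider $\mathcal G$ as a bidirected graph, by replacing every edge $uv$ with the two directed edges $\overrightarrow{uv}$ and $\overrightarrow{vu}$, and fix an arbitrary linear ordering of all of these directed edges. For an oriented spanning tree $T$ and a directed edge $e\in T$, the *fundamental cut* $C^*(T,e)$ is the set of all directed edges of the bidirected graph that connect the two components of $T-e$. The edge $e$ is *internally semi-passive* for $T$ if the maximal edge of $C^*(T,e)$, with respect to the fixed ordering, stands opposite to $e$, that is, if its head and the head of $e$ lie in different components of $T-e$. **Theorem.** For every dissecting tree set $\mathcal T$ for $\mathcal G$, every ordering of the directed edges, and every $i\ge 0$, the $h^*$-vector of $P_{\mathcal G}$ satisfies $$h^*_i=|\{T\in\mathcal T\mid T\text{ has exactly } i \text{ internally semi-passive edges}\}|.$$ -/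

import Mathlib

open Set
open scoped Pointwise

namespace SymmetricEdge

/-! ### Ehrhart theory -/

section Ehrhart

variable {V : Type*}

/-- The number of points of the lattice `ℤ^V` in the dilate `t • P`. -/
noncomputable def ehrhartCount (P : Set (V → ℝ)) (t : ℕ) : ℕ :=
  {z : V → ℤ | (fun v => (z v : ℝ)) ∈ (t : ℝ) • P}.ncard

/-- The dimension of the affine hull of `P`. -/
noncomputable def polytopeDim (P : Set (V → ℝ)) : ℕ :=
  Module.finrank ℝ (vectorSpan ℝ P)

/-- `a` is the `h^*`-vector of `P`: with `d = dim P`, the entries `a 0, …, a d` are the coefficients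
of the lattice point count of `t • P` with respect to the basis `t ↦ binom (t + d - k) d`,
`0 ≤ k ≤ d`, and the entries beyond `d` vanish. (As `k ≤ d`, the subtraction is not truncated.) -/
def IsHStarVector (P : Set (V → ℝ)) (a : ℕ → ℚ) : Prop :=
  (∀ t : ℕ, (ehrhartCount P t : ℚ) =
    ∑ k ∈ Finset.range (polytopeDim P + 1),
      a k * ((t + polytopeDim P - k).choose (polytopeDim P) : ℚ)) ∧
  ∀ k, polytopeDim P < k → a k = 0

/-- A set has at most one `h^*`-vector. -/
theorem IsHStarVector.unique {P : Set (V → ℝ)} {a b : ℕ → ℚ}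
    (ha : IsHStarVector P a) (hb : IsHStarVector P b) : a = b := by
  funext k
  induction k using Nat.strong_induction_on with
  | _ k ih =>
    rcases lt_or_ge (polytopeDim P) k with hk | hk
    · rw [ha.2 k hk, hb.2 k hk]
    · have h := (ha.1 k).symm.trans (hb.1 k)
      rw [← sub_eq_zero, ← Finset.sum_sub_distrib, Finset.sum_eq_single k] at h
      · have h1 : k + polytopeDim P - k = polytopeDim P := by omega
        rw [h1, Nat.choose_self] at h
        simpa [sub_eq_zero] using h
      · intro j hj hjk
        rcases lt_or_gt_of_ne hjk with h1 | h1
        · rw [ih j h1, sub_self]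
        · have hj2 := Finset.mem_range.1 hj
          rw [Nat.choose_eq_zero_of_lt (by omega)]
          simp
      · intro hk2
        exact absurd (Finset.mem_range.2 (by omega)) hk2

end Ehrhart

/-! ### The bidirected graph

The directed edges of the bidirected graph obtained from `G` are the darts `d : G.Dart`; the tail
of `d` is `d.fst` and the head of `d` is `d.snd`. -/

section Graph

variable {V : Type*} {G : SimpleGraph V}

/-- The undirected graph on `V` underlying a set of directed edges. -/
def underlyingGraph (T : Set G.Dart) : SimpleGraph V :=
  SimpleGraph.fromEdgeSet (SimpleGraph.Dart.edge '' T)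

/-- An oriented spanning tree of `G`: forgetting directions gives a tree on the whole vertex set,
and no edge is taken in both directions. -/
def IsOrientedSpanningTree (T : Set G.Dart) : Prop :=
  (underlyingGraph T).IsTree ∧ T.InjOn SimpleGraph.Dart.edge

/-- Two vertices lie in the same component of `T - e`. -/
def SameShore (T : Set G.Dart) (e : G.Dart) (u v : V) : Prop :=
  (underlyingGraph (T \ {e})).Reachable u v

/-- The fundamental cut of `e` with respect to `T`: all directed edges of the bidirected graph
that connect different components of `T - e`. -/
def fundamentalCut (T : Set G.Dart) (e : G.Dart) : Set G.Dart :=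
  {f | ¬ SameShore T e f.fst f.snd}

/-- An edge `f` of the fundamental cut stands opposite to `e` if the heads of `e` and `f` are in
different shores. -/
def StandsOpposite (T : Set G.Dart) (e f : G.Dart) : Prop :=
  ¬ SameShore T e e.snd f.snd

/-- `e ∈ T` is internally semi-passive for `T`: the maximal edge of its fundamental cut stands
opposite to `e`. -/
def IsInternallySemiPassive [LinearOrder G.Dart] (T : Set G.Dart) (e : G.Dart) : Prop :=
  e ∈ T ∧ ∃ f, IsGreatest (fundamentalCut T e) f ∧ StandsOpposite T e f

/-- The number of internally semi-passive edges of `T`. -/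
noncomputable def internalSemiPassivity [LinearOrder G.Dart] (T : Set G.Dart) : ℕ :=
  {e | IsInternallySemiPassive T e}.ncard

variable [DecidableEq V]

/-- The vector `1_h - 1_t` of a directed edge with head `h` and tail `t`. -/
def edgeVector (d : G.Dart) : V → ℝ :=
  Pi.single d.snd 1 - Pi.single d.fst 1

/-- The root polytope of a set of directed edges. -/
def rootPolytope (T : Set G.Dart) : Set (V → ℝ) :=
  convexHull ℝ (edgeVector '' T)

variable (G) in
/-- The symmetric edge polytope: the convex hull of `1_u - 1_v` and `1_v - 1_u` over all edges
`uv` of `G`. -/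
def symmetricEdgePolytope : Set (V → ℝ) :=
  convexHull ℝ {x | ∃ u v, G.Adj u v ∧
    (x = Pi.single u 1 - Pi.single v 1 ∨ x = Pi.single v 1 - Pi.single u 1)}

/-- A dissecting tree set for `G`: a set of oriented spanning trees whose simplices have pairwise
disjoint (relative) interiors and together cover exactly the (relative) boundary of the symmetric
edge polytope. -/
structure IsDissectingTreeSet (𝒯 : Set (Set G.Dart)) : Prop where
  isTree : ∀ T ∈ 𝒯, IsOrientedSpanningTree T
  interiorDisjoint : 𝒯.PairwiseDisjoint fun T => intrinsicInterior ℝ (rootPolytope T)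
  cover : ⋃ T ∈ 𝒯, rootPolytope T = intrinsicFrontier ℝ (symmetricEdgePolytope G)

end Graph

end SymmetricEdge

/-! Half-open decomposition in a generic direction. For an oriented spanning tree `T`, the edge
vectors are a basis of the hyperplane of coordinate sum zero, and the dual coordinate of `e` sums
the entries over the shore of `T - e` containing the head of `e` (`shoreForm_sum`,
`sum_shoreForm_smul`). Such coordinates are integers at lattice points, so every simplex is
unimodular.

Since the simplices of a dissecting tree set tile the boundary, their cones cover the hyperplane. On
the cone of `T`, the polytope is cut out by height at most 1, where height is the sum of the
coordinates (`sum_shoreForm_le`).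

Weight the directed edges by increasing powers of two and let `g` be the weighted sum of their
vectors. Only edges of the fundamental cut contribute to the `e`-coordinate of `g`, and the maximal
one dominates; hence that coordinate is negative exactly when `e` is internally semi-passive. Assign
each point `x` to the cone whose interior contains `x + ε g` for all small `ε > 0`. Each cone then
loses the facets of its semi-passive edges, and the resulting half-open cones partition the
hyperplane (`exists_mem_halfOpenCone`, `eq_of_mem_halfOpenCone`). With `k` semi-passive edges and
dimension `d`, a half-open cone has `binom (t + d - k) d` lattice points of height at most `t`;
summing over the trees gives the `h^*`-vector. -/

namespace SymmetricEdge

/-! ### Shores and fundamental cuts -/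

section Shore

variable {V : Type*} {G : SimpleGraph V} {T : Set G.Dart} {e f : G.Dart}

theorem underlyingGraph_adj {u v : V} :
    (underlyingGraph T).Adj u v ↔ ∃ f ∈ T, f.edge = s(u, v) := by
  simp only [underlyingGraph, SimpleGraph.fromEdgeSet_adj, Set.mem_image]
  refine ⟨fun h => h.1, fun h => ⟨h, ?_⟩⟩
  obtain ⟨f, -, hf⟩ := h
  have h1 : s(u, v) ∈ G.edgeSet := hf ▸ f.edge_mem
  exact G.ne_of_adj h1

theorem underlyingGraph_adj_of_mem (hf : f ∈ T) : (underlyingGraph T).Adj f.fst f.snd :=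
  underlyingGraph_adj.2 ⟨f, hf, rfl⟩

theorem underlyingGraph_sdiff_singleton (hT : T.InjOn SimpleGraph.Dart.edge) (he : e ∈ T) :
    underlyingGraph (T \ {e}) = (underlyingGraph T).deleteEdges {e.edge} := by
  ext u v
  simp only [SimpleGraph.deleteEdges_adj, underlyingGraph_adj, Set.mem_sdiff, Set.mem_singleton_iff]
  constructor
  · rintro ⟨f, ⟨hf, hfe⟩, h⟩
    exact ⟨⟨f, hf, h⟩, fun h' => hfe (hT hf he (h.trans h'))⟩
  · rintro ⟨⟨f, hf, h⟩, h'⟩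
    exact ⟨f, ⟨hf, fun hfe => h' (by rw [← h, hfe])⟩, h⟩

/-- The component of `T - e` that contains the head of `e`. -/
def headShore (T : Set G.Dart) (e : G.Dart) : Set V :=
  {v | SameShore T e e.snd v}

theorem snd_mem_headShore : e.snd ∈ headShore T e :=
  SimpleGraph.Reachable.refl _

theorem IsOrientedSpanningTree.not_sameShore (hT : IsOrientedSpanningTree T) (he : e ∈ T) :
    ¬ SameShore T e e.fst e.snd := by
  have h := SimpleGraph.isAcyclic_iff_forall_adj_isBridge.1 hT.1.isAcyclic
    (underlyingGraph_adj_of_mem he)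
  rw [SameShore, underlyingGraph_sdiff_singleton hT.2 he]
  exact h

theorem IsOrientedSpanningTree.fst_notMem_headShore (hT : IsOrientedSpanningTree T) (he : e ∈ T) :
    e.fst ∉ headShore T e :=
  fun h => hT.not_sameShore he (SimpleGraph.Reachable.symm h)

/-- Follow a walk in the tree from the head of `e`: a step along another edge stays in its
component, and a step along `e` ends at an endpoint of `e`. So `T - e` has no third component. -/
theorem IsOrientedSpanningTree.sameShore_fst_of_notMem (hT : IsOrientedSpanningTree T)
    (he : e ∈ T) {v : V} (hv : v ∉ headShore T e) : SameShore T e e.fst v := by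
  have key : ∀ v, SameShore T e e.snd v ∨ SameShore T e e.fst v := by
    intro v
    have h := hT.1.connected.preconnected e.snd v
    rw [SimpleGraph.reachable_iff_reflTransGen] at h
    induction h with
    | refl => exact Or.inl (SimpleGraph.Reachable.refl _)
    | @tail b c _ hbc ih =>
      by_cases hec : e.edge = s(b, c)
      · rcases SimpleGraph.dart_edge_eq_mk'_iff'.1 hec with ⟨-, h⟩ | ⟨h, -⟩
        · exact Or.inl (h ▸ SimpleGraph.Reachable.refl _)
        · exact Or.inr (h ▸ SimpleGraph.Reachable.refl _)
      · have hadj : (underlyingGraph (T \ {e})).Adj b c := by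
          rw [underlyingGraph_sdiff_singleton hT.2 he, SimpleGraph.deleteEdges_adj]
          exact ⟨hbc, fun h => hec h.symm⟩
        exact ih.imp (fun h => h.trans hadj.reachable) (fun h => h.trans hadj.reachable)
  exact (key v).resolve_left hv

theorem IsOrientedSpanningTree.mem_fundamentalCut_iff (hT : IsOrientedSpanningTree T)
    (he : e ∈ T) : f ∈ fundamentalCut T e ↔ ¬ (f.fst ∈ headShore T e ↔ f.snd ∈ headShore T e) := by
  rw [fundamentalCut, Set.mem_ofPred_eq, not_iff_not]
  constructor
  · exact fun h => ⟨fun h1 => SimpleGraph.Reachable.trans h1 h,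
      fun h1 => SimpleGraph.Reachable.trans h1 (SimpleGraph.Reachable.symm h)⟩
  · intro h
    by_cases h1 : f.fst ∈ headShore T e
    · exact SimpleGraph.Reachable.trans (SimpleGraph.Reachable.symm h1) (h.1 h1)
    · exact SimpleGraph.Reachable.trans
        (SimpleGraph.Reachable.symm (hT.sameShore_fst_of_notMem he h1))
        (hT.sameShore_fst_of_notMem he (fun h2 => h1 (h.2 h2)))

theorem fst_mem_headShore_iff_of_ne (hf : f ∈ T) (hfe : f ≠ e) :
    f.fst ∈ headShore T e ↔ f.snd ∈ headShore T e := by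
  have h : (underlyingGraph (T \ {e})).Adj f.fst f.snd := underlyingGraph_adj_of_mem ⟨hf, hfe⟩
  exact ⟨fun h1 => SimpleGraph.Reachable.trans h1 h.reachable,
    fun h1 => SimpleGraph.Reachable.trans h1 h.symm.reachable⟩

end Shore

/-! ### Edge vectors of a tree and their dual basis -/

section Basis

open Classical in
/-- The sum of the coordinates over the shore of `T - e` that contains the head of `e`. -/
noncomputable def shoreForm {V : Type*} [Fintype V] {G : SimpleGraph V} (T : Set G.Dart)
    (e : G.Dart) : (V → ℝ) →ₗ[ℝ] ℝ :=
  ∑ v with v ∈ headShore T e, LinearMap.proj v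

/-- The sum of all coordinates. -/
noncomputable def coordSum (V : Type*) [Fintype V] : (V → ℝ) →ₗ[ℝ] ℝ :=
  ∑ v : V, LinearMap.proj v

variable {V : Type*} [Fintype V] {G : SimpleGraph V} {T : Set G.Dart}
  {e f : G.Dart}

theorem coordSum_apply (x : V → ℝ) : coordSum V x = ∑ v, x v := by
  simp [coordSum]

open Classical in
theorem shoreForm_apply (x : V → ℝ) :
    shoreForm T e x = ∑ v with v ∈ headShore T e, x v := by
  simp [shoreForm]

theorem IsOrientedSpanningTree.card_add_one (hT : IsOrientedSpanningTree T) :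
    Nat.card T + 1 = Nat.card V := by
  rw [← (SimpleGraph.isTree_iff_connected_and_card.1 hT.1).2]
  congr 1
  have h : (underlyingGraph T).edgeSet = SimpleGraph.Dart.edge '' T := by
    rw [underlyingGraph, SimpleGraph.edgeSet_fromEdgeSet, sdiff_eq_left, Set.disjoint_left]
    rintro _ ⟨f, -, rfl⟩ hf
    exact G.not_isDiag_of_mem_edgeSet f.edge_mem hf
  rw [h]
  exact Nat.card_congr (Equiv.Set.imageOfInjOn _ _ hT.2)

variable [DecidableEq V]

open Classical in
theorem shoreForm_edgeVector : shoreForm T e (edgeVector f) =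
    (if f.snd ∈ headShore T e then 1 else 0) - (if f.fst ∈ headShore T e then 1 else 0) := by
  simp [shoreForm_apply, edgeVector, Finset.sum_sub_distrib]

@[simp]
theorem coordSum_edgeVector : coordSum V (edgeVector f) = 0 := by
  simp [coordSum_apply, edgeVector, Finset.sum_sub_distrib]

theorem IsOrientedSpanningTree.shoreForm_edgeVector_self (hT : IsOrientedSpanningTree T)
    (he : e ∈ T) : shoreForm T e (edgeVector e) = 1 := by
  rw [shoreForm_edgeVector, if_pos snd_mem_headShore, if_neg (hT.fst_notMem_headShore he), sub_zero]

theorem shoreForm_edgeVector_of_ne (hf : f ∈ T) (hfe : f ≠ e) :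
    shoreForm T e (edgeVector f) = 0 := by
  rw [shoreForm_edgeVector]
  have h := fst_mem_headShore_iff_of_ne hf hfe
  by_cases h1 : f.snd ∈ headShore T e <;> simp [h, h1]

open Classical in
-- Duality: `e` is the only edge of `T` that crosses between the shores of `T - e`.
theorem IsOrientedSpanningTree.shoreForm_sum (hT : IsOrientedSpanningTree T) (he : e ∈ T)
    (c : T → ℝ) : shoreForm T e (∑ f : T, c f • edgeVector f.1) = c ⟨e, he⟩ := by
  rw [map_sum, Finset.sum_eq_single ⟨e, he⟩]
  · simp [hT.shoreForm_edgeVector_self he]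
  · intro f _ hf
    rw [map_smul, shoreForm_edgeVector_of_ne f.2 (fun h => hf (Subtype.ext h)), smul_zero]
  · simp

theorem finrank_ker_coordSum [Nonempty V] :
    Module.finrank ℝ (LinearMap.ker (coordSum V)) + 1 = Nat.card V := by
  have h : coordSum V ≠ 0 := by
    intro h
    have h1 := LinearMap.congr_fun h (Pi.single (Classical.arbitrary V) 1)
    simp [coordSum_apply] at h1
  rw [Module.Dual.finrank_ker_add_one_of_ne_zero h]
  simp

theorem IsOrientedSpanningTree.linearIndependent (hT : IsOrientedSpanningTree T) :
    LinearIndependent ℝ (fun f : T => edgeVector f.1) := by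
  classical
  rw [Fintype.linearIndependent_iff]
  intro c hc i
  rw [← hT.shoreForm_sum i.2 c, hc, map_zero]

theorem IsOrientedSpanningTree.span_eq (hT : IsOrientedSpanningTree T) :
    Submodule.span ℝ (Set.range fun f : T => edgeVector f.1) = LinearMap.ker (coordSum V) := by
  classical
  have : Nonempty V := hT.1.connected.nonempty
  apply Submodule.eq_of_le_of_finrank_eq
  · rw [Submodule.span_le]
    rintro _ ⟨f, rfl⟩
    simp
  · rw [finrank_span_eq_card hT.linearIndependent]
    have h1 := hT.card_add_one
    have h2 := finrank_ker_coordSum (V := V)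
    rw [Nat.card_eq_fintype_card] at h1
    omega

open Classical in
theorem IsOrientedSpanningTree.sum_shoreForm_smul (hT : IsOrientedSpanningTree T) {x : V → ℝ}
    (hx : coordSum V x = 0) : ∑ f : T, shoreForm T f.1 x • edgeVector f.1 = x := by
  have h : x ∈ Submodule.span ℝ (Set.range fun f : T => edgeVector f.1) := by
    rw [hT.span_eq]; exact hx
  obtain ⟨c, hc⟩ := (Submodule.mem_span_range_iff_exists_fun ℝ).1 h
  conv_rhs => rw [← hc]
  refine Finset.sum_congr rfl fun f _ => ?_
  rw [← hc, hT.shoreForm_sum f.2]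

end Basis

/-! ### Intrinsic boundary and scaling from the origin -/

section Convex

variable {E : Type*} [AddCommGroup E] [Module ℝ E]

theorem linearMap_eq_of_mem_affineSpan {s : Set E} (l : E →ₗ[ℝ] ℝ) {c : ℝ}
    (h : ∀ x ∈ s, l x = c) {x : E} (hx : x ∈ affineSpan ℝ s) : l x = c := by
  refine affineSpan_induction (p := fun x => l x = c) hx h fun a u v w hu hv hw => ?_
  simp [hu, hv, hw]

variable [TopologicalSpace E] [ContinuousSMul ℝ E]

/-- The affine hull contains 0, so it contains the whole line through 0 and `x`; openness along this
line at `r = 1` leaves room beyond `x`. -/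
theorem exists_smul_mem_of_mem_intrinsicInterior {P : Set E} (h0 : (0 : E) ∈ P) {x : E}
    (hx : x ∈ intrinsicInterior ℝ P) : ∃ r : ℝ, 1 < r ∧ r • x ∈ P := by
  obtain ⟨y, hy, rfl⟩ := mem_intrinsicInterior.1 hx
  have h0' : (0 : E) ∈ affineSpan ℝ P := subset_affineSpan ℝ P h0
  have hmem : ∀ r : ℝ, r • (y : E) ∈ affineSpan ℝ P := by
    intro r
    have h := AffineMap.lineMap_mem r h0' y.2
    rwa [AffineMap.lineMap_apply_module', sub_zero, add_zero] at h
  let γ : ℝ → affineSpan ℝ P := fun r => ⟨r • (y : E), hmem r⟩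
  have hγ : Continuous γ := by fun_prop
  have h1 : γ 1 = y := Subtype.ext (one_smul ℝ _)
  have hnhds : γ ⁻¹' (interior ((↑) ⁻¹' P)) ∈ nhds (1 : ℝ) :=
    (isOpen_interior.preimage hγ).mem_nhds (by rw [Set.mem_preimage, h1]; exact hy)
  have hgt : γ ⁻¹' (interior ((↑) ⁻¹' P)) ∈ nhdsWithin (1 : ℝ) (Set.Ioi 1) :=
    mem_nhdsWithin_of_mem_nhds hnhds
  obtain ⟨r, hr, hr1⟩ := (Filter.nonempty_of_mem (Filter.inter_mem hgt self_mem_nhdsWithin))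
  exact ⟨r, hr1, interior_subset (s := ((↑) ⁻¹' P : Set (affineSpan ℝ P))) hr⟩

theorem mem_intrinsicFrontier_of_forall_smul_notMem {P : Set E} (h0 : (0 : E) ∈ P) {x : E}
    (hx : x ∈ P) (h : ∀ r : ℝ, 1 < r → r • x ∉ P) : x ∈ intrinsicFrontier ℝ P := by
  rw [← intrinsicClosure_sdiff_intrinsicInterior]
  refine ⟨subset_intrinsicClosure hx, fun hx' => ?_⟩
  obtain ⟨r, hr, hrx⟩ := exists_smul_mem_of_mem_intrinsicInterior h0 hx'
  exact h r hr hrx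

end Convex

theorem exists_smul_mem_and_forall_smul_notMem {E : Type*} [NormedAddCommGroup E]
    [NormedSpace ℝ E] {P : Set E} (hP : IsCompact P) {x : E} (hx0 : x ≠ 0) {s : ℝ} (hs : 0 < s)
    (hx : s • x ∈ P) :
    ∃ r : ℝ, 0 < r ∧ r • x ∈ P ∧ ∀ a : ℝ, 1 < a → a • r • x ∉ P := by
  have hK : IsCompact ((fun r : ℝ => r • x) ⁻¹' P) :=
    (isClosedEmbedding_smul_left hx0).isCompact_preimage hP
  obtain ⟨r, hr, hmax⟩ := hK.exists_isGreatest ⟨s, hx⟩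
  have hr0 : 0 < r := hs.trans_le (hmax hx)
  refine ⟨r, hr0, hr, fun a ha h => ?_⟩
  rw [smul_smul] at h
  have h1 : a * r ≤ r := hmax h
  nlinarith

/-! ### The symmetric edge polytope and the tree simplices -/

section Polytope

variable {V : Type*} [DecidableEq V] {G : SimpleGraph V} {T : Set G.Dart} {e f : G.Dart}

theorem symmetricEdgePolytope_eq_convexHull_range :
    symmetricEdgePolytope G = convexHull ℝ (Set.range (edgeVector (G := G))) := by
  rw [symmetricEdgePolytope]
  congr 1
  ext x
  constructor
  · rintro ⟨u, v, h, rfl | rfl⟩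
    · exact ⟨⟨(v, u), h.symm⟩, rfl⟩
    · exact ⟨⟨(u, v), h⟩, rfl⟩
  · rintro ⟨d, rfl⟩
    exact ⟨d.snd, d.fst, d.adj.symm, Or.inl rfl⟩

theorem convex_symmetricEdgePolytope : Convex ℝ (symmetricEdgePolytope G) :=
  convex_convexHull ℝ _

theorem edgeVector_mem : edgeVector f ∈ symmetricEdgePolytope G := by
  rw [symmetricEdgePolytope_eq_convexHull_range]
  exact subset_convexHull ℝ _ ⟨f, rfl⟩

theorem edgeVector_symm : edgeVector f.symm = -edgeVector f := by
  simp [edgeVector]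

theorem edgeVector_ne_zero : edgeVector f ≠ 0 := by
  intro h
  have h1 := congrFun h f.snd
  simp [edgeVector, f.adj.ne'] at h1

theorem zero_mem_symmetricEdgePolytope (f : G.Dart) : 0 ∈ symmetricEdgePolytope G := by
  have h := convex_symmetricEdgePolytope (G := G) (edgeVector_mem (f := f))
    (edgeVector_mem (f := f.symm)) (a := 1 / 2) (b := 1 / 2) (by norm_num) (by norm_num)
    (by norm_num)
  simpa [edgeVector_symm] using h

variable [Fintype V]

theorem isCompact_symmetricEdgePolytope : IsCompact (symmetricEdgePolytope G) := by
  classical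
  rw [symmetricEdgePolytope_eq_convexHull_range]
  exact (Set.finite_range _).isCompact_convexHull ℝ

theorem coordSum_eq_zero_of_mem_affineSpan {x : V → ℝ}
    (hx : x ∈ affineSpan ℝ (symmetricEdgePolytope G)) : coordSum V x = 0 := by
  rw [symmetricEdgePolytope_eq_convexHull_range, affineSpan_convexHull] at hx
  refine linearMap_eq_of_mem_affineSpan _ ?_ hx
  rintro _ ⟨f, rfl⟩
  exact coordSum_edgeVector

theorem coordSum_eq_zero_of_mem {x : V → ℝ} (hx : x ∈ symmetricEdgePolytope G) :
    coordSum V x = 0 :=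
  coordSum_eq_zero_of_mem_affineSpan (subset_affineSpan ℝ _ hx)

open Classical in
-- The polytope contains the cross-polytope on the edge vectors of `T` and their negatives.
theorem IsOrientedSpanningTree.mem_symmetricEdgePolytope (hT : IsOrientedSpanningTree T)
    (f : G.Dart) {x : V → ℝ} (hx : coordSum V x = 0) (hx1 : ∑ e : T, |shoreForm T e.1 x| ≤ 1) :
    x ∈ symmetricEdgePolytope G := by
  rw [← hT.sum_shoreForm_smul hx]
  -- The extra index `none` puts the leftover weight on the origin; signs choose between an edge and
  -- its reverse.
  have h := convex_symmetricEdgePolytope (G := G).sum_mem (t := (Finset.univ : Finset (Option T)))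
    (w := fun o => o.elim (1 - ∑ e : T, |shoreForm T e.1 x|) fun e => |shoreForm T e.1 x|)
    (z := fun o => o.elim 0 fun e => (SignType.sign (shoreForm T e.1 x) : ℝ) • edgeVector e.1)
    ?_ ?_ ?_
  · simpa [Fintype.sum_option, smul_smul, abs_mul_sign] using h
  · rintro (_ | e) -
    · simpa using hx1
    · exact abs_nonneg _
  · simp [Fintype.sum_option]
  · rintro (_ | e) -
    · exact zero_mem_symmetricEdgePolytope f
    · rcases lt_trichotomy (shoreForm T e.1 x) 0 with h | h | h
      · simpa [h, edgeVector_symm] using edgeVector_mem (f := e.1.symm)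
      · simpa [h] using zero_mem_symmetricEdgePolytope f
      · simpa [h] using edgeVector_mem (f := e.1)

theorem IsOrientedSpanningTree.smul_mem_intrinsicInterior (hT : IsOrientedSpanningTree T)
    (f : G.Dart) {x : V → ℝ} (hx : x ∈ symmetricEdgePolytope G) {r : ℝ} (hr0 : 0 ≤ r)
    (hr1 : r < 1) : r • x ∈ intrinsicInterior ℝ (symmetricEdgePolytope G) := by
  classical
  have h0 := zero_mem_symmetricEdgePolytope f
  have hrx : r • x ∈ symmetricEdgePolytope G := by
    have := convex_symmetricEdgePolytope (G := G).starConvex h0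
    exact this.smul_mem hx hr0 hr1.le
  refine mem_intrinsicInterior.2 ⟨⟨r • x, subset_affineSpan ℝ _ hrx⟩, ?_, rfl⟩
  -- The neighbourhood is the open cross-polytope of radius `1 - r` about `r • x`: each of its
  -- points is `r • x + (1 - r) • u` with `u` in the polytope.
  refine mem_interior.2 ⟨{w | ∑ e : T, |shoreForm T e.1 ((w : V → ℝ) - r • x)| < 1 - r}, ?_, ?_, ?_⟩
  · intro w hw
    have hu : (1 - r)⁻¹ • ((w : V → ℝ) - r • x) ∈ symmetricEdgePolytope G := by
      refine hT.mem_symmetricEdgePolytope f ?_ ?_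
      · simp [coordSum_eq_zero_of_mem_affineSpan w.2, coordSum_eq_zero_of_mem hx]
      · simp only [map_smul, smul_eq_mul, abs_mul]
        rw [← Finset.mul_sum, abs_of_pos (inv_pos.2 (sub_pos.2 hr1)), inv_mul_le_iff₀ (sub_pos.2 hr1),
          mul_one]
        exact le_of_lt hw
    have := convex_symmetricEdgePolytope (G := G) hx hu hr0 (sub_nonneg.2 hr1.le) (by ring)
    rwa [smul_inv_smul₀ (sub_pos.2 hr1).ne', add_sub_cancel] at this
  · refine isOpen_lt ?_ continuous_const
    refine continuous_finsetSum _ fun e _ => ?_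
    have := (shoreForm T e.1).continuous_of_finiteDimensional
    fun_prop
  · simpa using hr1

theorem IsOrientedSpanningTree.mem_intrinsicFrontier_iff (hT : IsOrientedSpanningTree T)
    (f : G.Dart) {x : V → ℝ} : x ∈ intrinsicFrontier ℝ (symmetricEdgePolytope G) ↔
      x ∈ symmetricEdgePolytope G ∧ ∀ r : ℝ, 1 < r → r • x ∉ symmetricEdgePolytope G := by
  constructor
  · intro hx
    refine ⟨intrinsicFrontier_subset isCompact_symmetricEdgePolytope.isClosed hx,
      fun r hr hrx => ?_⟩
    have h := hT.smul_mem_intrinsicInterior f hrx (inv_nonneg.2 (zero_le_one.trans hr.le))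
      (inv_lt_one_of_one_lt₀ hr)
    rw [inv_smul_smul₀ (zero_lt_one.trans hr).ne'] at h
    rw [← intrinsicClosure_sdiff_intrinsicInterior] at hx
    exact hx.2 h
  · exact fun h => mem_intrinsicFrontier_of_forall_smul_notMem
      (zero_mem_symmetricEdgePolytope f) h.1 h.2

open Classical in
theorem IsOrientedSpanningTree.mem_rootPolytope (hT : IsOrientedSpanningTree T) {x : V → ℝ}
    (hx : coordSum V x = 0) (hx0 : ∀ e ∈ T, 0 ≤ shoreForm T e x)
    (hx1 : ∑ e : T, shoreForm T e.1 x = 1) : x ∈ rootPolytope T := by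
  rw [← hT.sum_shoreForm_smul hx]
  exact (convex_convexHull ℝ _).sum_mem (fun e _ => hx0 e.1 e.2) hx1
    fun e _ => subset_convexHull ℝ _ ⟨e.1, e.2, rfl⟩

theorem IsOrientedSpanningTree.shoreForm_nonneg_of_mem_rootPolytope
    (hT : IsOrientedSpanningTree T) {x : V → ℝ} (hx : x ∈ rootPolytope T) (he : e ∈ T) :
    0 ≤ shoreForm T e x := by
  have h : rootPolytope T ⊆ {x | 0 ≤ shoreForm T e x} := by
    refine convexHull_min ?_ ?_
    · rintro _ ⟨f, hf, rfl⟩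
      by_cases h : f = e
      · subst h
        simp [hT.shoreForm_edgeVector_self he]
      · simp [shoreForm_edgeVector_of_ne hf h]
    · exact convex_halfSpace_ge (shoreForm T e).isLinear 0
  exact h hx

open Classical in
-- On the affine hull of the simplex the coordinates automatically sum to 1, so only the strict
-- inequalities remain, and these are open.
theorem IsOrientedSpanningTree.mem_intrinsicInterior_rootPolytope (hT : IsOrientedSpanningTree T)
    {x : V → ℝ} (hx : coordSum V x = 0) (hx0 : ∀ e ∈ T, 0 < shoreForm T e x)
    (hx1 : ∑ e : T, shoreForm T e.1 x = 1) : x ∈ intrinsicInterior ℝ (rootPolytope T) := by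
  have hxQ := hT.mem_rootPolytope hx (fun e he => (hx0 e he).le) hx1
  refine mem_intrinsicInterior.2 ⟨⟨x, subset_affineSpan ℝ _ hxQ⟩, ?_, rfl⟩
  refine mem_interior.2 ⟨⋂ e : T, {w | 0 < shoreForm T e.1 (w : V → ℝ)}, ?_, ?_, ?_⟩
  · rintro ⟨w, hw⟩ h
    rw [rootPolytope, affineSpan_convexHull] at hw
    refine hT.mem_rootPolytope ?_ (fun e he => (Set.mem_iInter.1 h ⟨e, he⟩).le) ?_
    · refine linearMap_eq_of_mem_affineSpan _ ?_ hw
      rintro _ ⟨f, -, rfl⟩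
      exact coordSum_edgeVector
    · have := linearMap_eq_of_mem_affineSpan (∑ e : T, shoreForm T e.1) (c := 1) ?_ hw
      · simpa using this
      · rintro _ ⟨f, hf, rfl⟩
        rw [LinearMap.sum_apply, Finset.sum_eq_single ⟨f, hf⟩]
        · exact hT.shoreForm_edgeVector_self hf
        · exact fun e _ h => shoreForm_edgeVector_of_ne hf fun h' => h (Subtype.ext h'.symm)
        · simp
  · refine isOpen_iInter_of_finite fun e => isOpen_lt continuous_const ?_
    have := (shoreForm T e.1).continuous_of_finiteDimensional
    fun_prop
  · exact Set.mem_iInter.2 fun e => hx0 e.1 e.2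

end Polytope

instance finite_dart {V : Type*} [Finite V] (G : SimpleGraph V) : Finite G.Dart := by
  classical
  have := Fintype.ofFinite V
  infer_instance

/-! ### Coordinates of arbitrary edges -/

section Shore

variable {V : Type*} [Fintype V] [DecidableEq V] {G : SimpleGraph V} {T : Set G.Dart} {e : G.Dart}

theorem abs_shoreForm_edgeVector_le (f : G.Dart) : |shoreForm T e (edgeVector f)| ≤ 1 := by
  rw [shoreForm_edgeVector]
  split_ifs <;> simp

theorem IsOrientedSpanningTree.shoreForm_edgeVector_of_notMem_fundamentalCut
    (hT : IsOrientedSpanningTree T) (he : e ∈ T) {f : G.Dart} (hf : f ∉ fundamentalCut T e) :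
    shoreForm T e (edgeVector f) = 0 := by
  rw [hT.mem_fundamentalCut_iff he, not_not] at hf
  rw [shoreForm_edgeVector]
  by_cases h : f.snd ∈ headShore T e <;> simp [hf, h]

end Shore

/-! ### The generic direction -/

section Generic

theorem strictMono_ncard_Iio {α : Type*} [Finite α] [LinearOrder α] :
    StrictMono fun a : α => (Set.Iio a).ncard :=
  fun _ _ hab => Set.ncard_lt_ncard
    ⟨Set.Iio_subset_Iio hab.le, fun h => lt_irrefl _ (h hab)⟩ (Set.toFinite _)

/-- The smaller powers of two sum to less than the power at `m`, so the terms below `m` cannot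
cancel it. -/
theorem sum_two_pow_mul_pos {α : Type*} [Fintype α] [LinearOrder α] {w : α → ℝ} {m : α}
    (hm : w m = 1) (hle : ∀ a, |w a| ≤ 1) (hlt : ∀ a, m < a → w a = 0) :
    0 < ∑ a, 2 ^ (Set.Iio a).ncard * w a := by
  have h1 : ∑ a ∈ Finset.univ.filter (· < m), (2 : ℕ) ^ (Set.Iio a).ncard
      < 2 ^ (Set.Iio m).ncard := by
    rw [← Finset.sum_image (f := fun k => 2 ^ k) (g := fun a : α => (Set.Iio a).ncard)
      (strictMono_ncard_Iio.injective.injOn)]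
    refine Nat.geomSum_lt le_rfl fun k hk => ?_
    obtain ⟨a, ha, rfl⟩ := Finset.mem_image.1 hk
    exact strictMono_ncard_Iio (Finset.mem_filter.1 ha).2
  have h2 : ∑ a ∈ Finset.univ.filter (· < m), (2 : ℝ) ^ (Set.Iio a).ncard
      < 2 ^ (Set.Iio m).ncard := by exact_mod_cast h1
  rw [← Finset.sum_filter_add_sum_filter_not Finset.univ (· < m)]
  have h3 : ∑ a ∈ Finset.univ.filter (fun a => ¬ a < m), 2 ^ (Set.Iio a).ncard * w a
      = 2 ^ (Set.Iio m).ncard := by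
    rw [Finset.sum_eq_single m]
    · rw [hm, mul_one]
    · intro a ha ham
      rw [hlt a (lt_of_le_of_ne (not_lt.1 (Finset.mem_filter.1 ha).2) ham.symm), mul_zero]
    · simp
  have h4 : -∑ a ∈ Finset.univ.filter (· < m), (2 : ℝ) ^ (Set.Iio a).ncard
      ≤ ∑ a ∈ Finset.univ.filter (· < m), 2 ^ (Set.Iio a).ncard * w a := by
    rw [← Finset.sum_neg_distrib]
    refine Finset.sum_le_sum fun a _ => ?_
    have := (abs_le.1 (hle a)).1
    have h5 : (0 : ℝ) < 2 ^ (Set.Iio a).ncard := by positivity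
    nlinarith
  rw [h3]
  linarith

variable {V : Type*} [Fintype V] [DecidableEq V] {G : SimpleGraph V} {T : Set G.Dart} {e : G.Dart}
  [LinearOrder G.Dart]

variable (G) in
open Classical in
/-- A vector whose coordinates with respect to every oriented spanning tree are nonzero, the sign
being determined by the maximal edge of the fundamental cut. -/
noncomputable def genericVector : V → ℝ :=
  ∑ f : G.Dart, (2 : ℝ) ^ (Set.Iio f).ncard • edgeVector f

@[simp]
theorem coordSum_genericVector : coordSum V (genericVector G) = 0 := by
  simp [genericVector]

open Classical in
theorem shoreForm_genericVector : shoreForm T e (genericVector G) =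
    ∑ f : G.Dart, 2 ^ (Set.Iio f).ncard * shoreForm T e (edgeVector f) := by
  simp [genericVector]

open Classical in
theorem IsOrientedSpanningTree.shoreForm_genericVector_neg (hT : IsOrientedSpanningTree T)
    (h : IsInternallySemiPassive T e) : shoreForm T e (genericVector G) < 0 := by
  obtain ⟨he, m, ⟨hm, hmax⟩, hopp⟩ := h
  rw [shoreForm_genericVector, ← neg_pos, ← Finset.sum_neg_distrib]
  simp only [← mul_neg]
  refine sum_two_pow_mul_pos (m := m) ?_ (fun f => ?_) fun f hf => ?_
  · have h1 : m.snd ∉ headShore T e := hopp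
    have h2 := (hT.mem_fundamentalCut_iff he).1 hm
    have h3 : m.fst ∈ headShore T e := by tauto
    rw [shoreForm_edgeVector, if_pos h3, if_neg h1]
    norm_num
  · rw [abs_neg]
    exact abs_shoreForm_edgeVector_le f
  · rw [hT.shoreForm_edgeVector_of_notMem_fundamentalCut he fun h => (hmax h).not_gt hf, neg_zero]

open Classical in
theorem IsOrientedSpanningTree.shoreForm_genericVector_pos (hT : IsOrientedSpanningTree T)
    (he : e ∈ T) (h : ¬ IsInternallySemiPassive T e) : 0 < shoreForm T e (genericVector G) := by
  obtain ⟨m, hm, hmax⟩ := (Set.toFinite (fundamentalCut T e)).exists_maximal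
    ⟨e, hT.not_sameShore he⟩
  have hgr : IsGreatest (fundamentalCut T e) m :=
    ⟨hm, fun f hf => (le_total f m).elim id fun h => hmax hf h⟩
  rw [shoreForm_genericVector]
  refine sum_two_pow_mul_pos (m := m) ?_ abs_shoreForm_edgeVector_le fun f hf => ?_
  · have h1 : m.snd ∈ headShore T e := by
      by_contra h1
      exact h ⟨he, m, hgr, h1⟩
    have h2 := (hT.mem_fundamentalCut_iff he).1 hm
    have h3 : m.fst ∉ headShore T e := by tauto
    rw [shoreForm_edgeVector, if_pos h1, if_neg h3, sub_zero]
  · exact hT.shoreForm_edgeVector_of_notMem_fundamentalCut he fun h => (hgr.2 h).not_gt hf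

end Generic

/-! ### Cones over a dissecting tree set -/

section Dissecting

variable {V : Type*} [Fintype V] [DecidableEq V] {G : SimpleGraph V} {T : Set G.Dart}
  {𝒯 : Set (Set G.Dart)}

theorem IsDissectingTreeSet.nonempty (h𝒯 : IsDissectingTreeSet 𝒯) (f : G.Dart) :
    𝒯.Nonempty := by
  have h1 : (1 : ℝ) • edgeVector f ∈ symmetricEdgePolytope G := by
    rw [one_smul]; exact edgeVector_mem
  obtain ⟨r, -, hr, h⟩ := exists_smul_mem_and_forall_smul_notMem isCompact_symmetricEdgePolytope
    (edgeVector_ne_zero (f := f)) one_pos h1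
  have h2 := mem_intrinsicFrontier_of_forall_smul_notMem (zero_mem_symmetricEdgePolytope f) hr h
  rw [← h𝒯.cover] at h2
  obtain ⟨T, hT, -⟩ := Set.mem_iUnion₂.1 h2
  exact ⟨T, hT⟩

/-- The ray through `x` leaves the polytope at a boundary point, which lies in some simplex;
positive scaling keeps the signs of the coordinates. -/
theorem IsDissectingTreeSet.exists_shoreForm_nonneg (h𝒯 : IsDissectingTreeSet 𝒯) (f : G.Dart)
    {x : V → ℝ} (hx : coordSum V x = 0) : ∃ T ∈ 𝒯, ∀ e ∈ T, 0 ≤ shoreForm T e x := by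
  classical
  obtain ⟨T₀, hT₀⟩ := h𝒯.nonempty f
  rcases eq_or_ne x 0 with rfl | hx0
  · exact ⟨T₀, hT₀, fun e _ => by simp⟩
  have hs : 0 ≤ ∑ e : T₀, |shoreForm T₀ e.1 x| := Finset.sum_nonneg fun _ _ => abs_nonneg _
  have hs' : 0 < (∑ e : T₀, |shoreForm T₀ e.1 x| + 1)⁻¹ := by positivity
  have hmem : (∑ e : T₀, |shoreForm T₀ e.1 x| + 1)⁻¹ • x ∈ symmetricEdgePolytope G := by
    refine (h𝒯.isTree T₀ hT₀).mem_symmetricEdgePolytope f (by simp [hx]) ?_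
    simp only [map_smul, smul_eq_mul, abs_mul]
    rw [← Finset.mul_sum, abs_of_pos hs', inv_mul_le_iff₀ (by positivity)]
    linarith
  obtain ⟨r, hr0, hr, h⟩ := exists_smul_mem_and_forall_smul_notMem
    isCompact_symmetricEdgePolytope hx0 hs' hmem
  have h2 := mem_intrinsicFrontier_of_forall_smul_notMem (zero_mem_symmetricEdgePolytope f) hr h
  rw [← h𝒯.cover] at h2
  obtain ⟨T, hT, hrT⟩ := Set.mem_iUnion₂.1 h2
  refine ⟨T, hT, fun e he => ?_⟩
  have h3 := (h𝒯.isTree T hT).shoreForm_nonneg_of_mem_rootPolytope hrT he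
  rw [map_smul, smul_eq_mul] at h3
  exact nonneg_of_mul_nonneg_right h3 hr0

open Classical in
-- If the height `s` exceeded 1, then `s⁻¹ • x` would lie in the simplex, hence on the boundary, yet
-- stretching it by `s > 1` would stay in the polytope.
theorem IsDissectingTreeSet.sum_shoreForm_le (h𝒯 : IsDissectingTreeSet 𝒯) (hT : T ∈ 𝒯)
    {x : V → ℝ} (hx : x ∈ symmetricEdgePolytope G) (hx0 : ∀ e ∈ T, 0 ≤ shoreForm T e x) :
    ∑ e : T, shoreForm T e.1 x ≤ 1 := by
  by_contra! hs
  have hs0 := zero_lt_one.trans hs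
  have hmem : (∑ e : T, shoreForm T e.1 x)⁻¹ • x ∈ rootPolytope T := by
    refine (h𝒯.isTree T hT).mem_rootPolytope (by simp [coordSum_eq_zero_of_mem hx])
      (fun e he => ?_) ?_
    · rw [map_smul]
      exact mul_nonneg (inv_nonneg.2 hs0.le) (hx0 e he)
    · simp only [map_smul, smul_eq_mul]
      rw [← Finset.mul_sum, inv_mul_cancel₀ hs0.ne']
  have hfr : (∑ e : T, shoreForm T e.1 x)⁻¹ • x ∈ intrinsicFrontier ℝ (symmetricEdgePolytope G) := by
    rw [← h𝒯.cover]
    exact Set.mem_iUnion₂.2 ⟨T, hT, hmem⟩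
  have hne : Nonempty T := by
    by_contra hne
    rw [not_nonempty_iff] at hne
    simp at hs0
  have := (((h𝒯.isTree T hT).mem_intrinsicFrontier_iff hne.some.1).1 hfr).2 _ hs
  rw [smul_inv_smul₀ hs0.ne'] at this
  exact this hx

end Dissecting

/-! ### Partition into half-open cones -/

section HalfOpen

open Filter Topology

theorem eventually_pos_add_mul {a b : ℝ} (h : 0 < a ∨ (0 ≤ a ∧ 0 < b)) :
    ∀ᶠ ε in 𝓝[>] (0 : ℝ), 0 < a + ε * b := by
  rcases h with h | ⟨ha, hb⟩
  · have h1 : Tendsto (fun ε : ℝ => a + ε * b) (𝓝 0) (𝓝 (a + 0 * b)) :=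
      Continuous.tendsto (by fun_prop) 0
    exact (h1.mono_left nhdsWithin_le_nhds).eventually (lt_mem_nhds (by simpa using h))
  · filter_upwards [self_mem_nhdsWithin] with ε hε
    have : 0 < ε * b := mul_pos hε hb
    linarith

variable {V : Type*} [Fintype V] {G : SimpleGraph V} [LinearOrder G.Dart]

/-- The cone over the simplex of `T`, without the facets opposite to the internally semi-passive
edges of `T`. -/
def halfOpenCone (T : Set G.Dart) : Set (V → ℝ) :=
  {x | coordSum V x = 0 ∧
    ∀ e ∈ T, 0 ≤ shoreForm T e x ∧ (IsInternallySemiPassive T e → 0 < shoreForm T e x)}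

variable [DecidableEq V] {T T' : Set G.Dart} {𝒯 : Set (Set G.Dart)}

theorem IsOrientedSpanningTree.eventually_shoreForm_pos (hT : IsOrientedSpanningTree T)
    {x : V → ℝ} (hx : x ∈ halfOpenCone T) :
    ∀ᶠ ε in 𝓝[>] (0 : ℝ), ∀ e ∈ T, 0 < shoreForm T e (x + ε • genericVector G) := by
  rw [Filter.eventually_all_finite (Set.toFinite T)]
  intro e he
  simp only [map_add, map_smul, smul_eq_mul]
  refine eventually_pos_add_mul ?_
  by_cases h : IsInternallySemiPassive T e
  · exact Or.inl ((hx.2 e he).2 h)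
  · exact Or.inr ⟨(hx.2 e he).1, hT.shoreForm_genericVector_pos he h⟩

/-- Complements `eventually_shoreForm_pos`: by genericity, a small perturbation of a point ends up
either inside the open cone or outside the closed one. -/
theorem IsOrientedSpanningTree.eventually_exists_shoreForm_neg (hT : IsOrientedSpanningTree T)
    {x : V → ℝ} (hx0 : coordSum V x = 0) (hx : x ∉ halfOpenCone T) :
    ∀ᶠ ε in 𝓝[>] (0 : ℝ), ∃ e ∈ T, shoreForm T e (x + ε • genericVector G) < 0 := by
  have h : ∃ e ∈ T, shoreForm T e x < 0 ∨
      (shoreForm T e x ≤ 0 ∧ IsInternallySemiPassive T e) := by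
    by_contra! h
    exact hx ⟨hx0, fun e he => ⟨(h e he).1, fun h1 => not_le.1 fun h2 => (h e he).2 h2 h1⟩⟩
  obtain ⟨e, he, h⟩ := h
  have h1 : ∀ᶠ ε in 𝓝[>] (0 : ℝ),
      0 < -shoreForm T e x + ε * -shoreForm T e (genericVector G) := by
    refine eventually_pos_add_mul (h.imp neg_pos.2 fun h => ⟨neg_nonneg.2 h.1, neg_pos.2 ?_⟩)
    exact hT.shoreForm_genericVector_neg h.2
  filter_upwards [h1] with ε hε
  refine ⟨e, he, ?_⟩
  simp only [map_add, map_smul, smul_eq_mul]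
  linarith

theorem IsDissectingTreeSet.exists_mem_halfOpenCone (h𝒯 : IsDissectingTreeSet 𝒯) (f : G.Dart)
    {x : V → ℝ} (hx : coordSum V x = 0) : ∃ T ∈ 𝒯, x ∈ halfOpenCone T := by
  by_contra! h
  have h1 : ∀ᶠ ε in 𝓝[>] (0 : ℝ), ∀ T ∈ 𝒯,
      ∃ e ∈ T, shoreForm T e (x + ε • genericVector G) < 0 := by
    -- There are finitely many trees, so one `ε` serves them all.
    rw [Filter.eventually_all_finite (Set.toFinite 𝒯)]
    exact fun T hT => (h𝒯.isTree T hT).eventually_exists_shoreForm_neg hx (h T hT)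
  obtain ⟨ε, hε⟩ := h1.exists
  obtain ⟨T, hT, hT'⟩ := h𝒯.exists_shoreForm_nonneg f
    (x := x + ε • genericVector G) (by simp [hx])
  obtain ⟨e, he, hlt⟩ := hε T hT
  exact (hT' e he).not_gt hlt

/-- The perturbed point lies in both open cones and has the same height in both, so one rescaling
puts it in both simplex interiors, which are disjoint for distinct trees. -/
theorem IsDissectingTreeSet.eq_of_mem_halfOpenCone (h𝒯 : IsDissectingTreeSet 𝒯) (f : G.Dart)
    (hT : T ∈ 𝒯) (hT' : T' ∈ 𝒯) {x : V → ℝ} (hx : x ∈ halfOpenCone T)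
    (hx' : x ∈ halfOpenCone T') : T = T' := by
  classical
  obtain ⟨ε, h1, h2⟩ := (((h𝒯.isTree T hT).eventually_shoreForm_pos hx).and
    ((h𝒯.isTree T' hT').eventually_shoreForm_pos hx')).exists
  have hy : coordSum V (x + ε • genericVector G) = 0 := by simp [hx.1]
  generalize x + ε • genericVector G = y at h1 h2 hy
  have key : ∀ S ∈ 𝒯, (∀ e ∈ S, 0 < shoreForm S e y) → 0 < ∑ e : S, shoreForm S e.1 y := by
    intro S hS h
    refine Finset.sum_pos (fun e _ => h e.1 e.2) ?_
    rw [Finset.univ_nonempty_iff]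
    have hc := (h𝒯.isTree S hS).card_add_one
    have : Nontrivial V := ⟨⟨f.fst, f.snd, f.adj.ne⟩⟩
    have hV := Finite.one_lt_card (α := V)
    exact (Nat.card_pos_iff.1 (by omega)).1
  have key2 : ∀ S ∈ 𝒯, ∀ c : ℝ, 0 < c → (∀ e ∈ S, 0 < shoreForm S e y) →
      ∑ e : S, shoreForm S e.1 y = c → c⁻¹ • y ∈ intrinsicInterior ℝ (rootPolytope S) := by
    intro S hS c hc h hsum
    refine (h𝒯.isTree S hS).mem_intrinsicInterior_rootPolytope (by simp [hy]) (fun e he => ?_) ?_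
    · rw [map_smul]
      exact mul_pos (inv_pos.2 hc) (h e he)
    · simp only [map_smul, smul_eq_mul]
      rw [← Finset.mul_sum, hsum, inv_mul_cancel₀ hc.ne']
  -- Dividing `y` by its height for `S'` gives a point of the polytope, whose height for `S` is
  -- therefore at most 1.
  have key3 : ∀ S ∈ 𝒯, ∀ S' ∈ 𝒯, (∀ e ∈ S, 0 < shoreForm S e y) →
      (∀ e ∈ S', 0 < shoreForm S' e y) →
      ∑ e : S, shoreForm S e.1 y ≤ ∑ e : S', shoreForm S' e.1 y := by
    intro S hS S' hS' h h'
    have hmem := intrinsicInterior_subset (key2 S' hS' _ (key S' hS' h') h' rfl)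
    have hP : (∑ e : S', shoreForm S' e.1 y)⁻¹ • y ∈ symmetricEdgePolytope G :=
      convexHull_mono (s := edgeVector '' S') (by
        rintro _ ⟨g, -, rfl⟩
        exact ⟨g.snd, g.fst, g.adj.symm, Or.inl rfl⟩) hmem
    have hpos := key S' hS' h'
    have := h𝒯.sum_shoreForm_le hS hP fun e he => by
      rw [map_smul]
      exact mul_nonneg (inv_nonneg.2 hpos.le) (h e he).le
    simp only [map_smul, smul_eq_mul] at this
    rwa [← Finset.mul_sum, inv_mul_le_iff₀ hpos, mul_one] at this
  by_contra hne
  have hdisj := h𝒯.interiorDisjoint hT hT' hne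
  refine Set.disjoint_left.1 hdisj (key2 T hT _ (key T hT h1) h1 rfl) (key2 T' hT' _ (key T hT h1) h2 ?_)
  exact le_antisymm (key3 T' hT' T hT h2 h1) (key3 T hT T' hT' h1 h2)

end HalfOpen

/-! ### Stars and bars -/

section StarsAndBars

variable {ι : Type*} [Fintype ι]

theorem card_sum_le (m : ℕ) : Nat.card {c : ι → ℕ // ∑ i, c i ≤ m} =
    (m + Fintype.card ι).choose (Fintype.card ι) := by
  classical
  -- A slack variable at `none` turns the inequality into an equation.
  have e : {c : ι → ℕ // ∑ i, c i ≤ m} ≃ {c : Option ι → ℕ // ∑ i, c i = m} :=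
    { toFun := fun c => ⟨fun o => o.elim (m - ∑ i, c.1 i) c.1, by
        have := c.2
        simp only [Fintype.sum_option, Option.elim]
        omega⟩
      invFun := fun c => ⟨fun i => c.1 (some i), by
        have := c.2
        rw [Fintype.sum_option] at this
        exact (Nat.le_add_left _ _).trans this.le⟩
      left_inv := fun c => rfl
      right_inv := fun c => by
        have := c.2
        rw [Fintype.sum_option] at this
        ext (_ | i)
        · simp only [Option.elim]
          omega
        · rfl }
  rw [Nat.card_congr (e.trans (Sym.equivNatSumOfFintype (Option ι) m).symm),
    Nat.card_eq_fintype_card, Sym.card_sym_eq_choose, Fintype.card_option, ← Nat.choose_symm_add]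
  congr 1
  omega

theorem finite_sum_le (m : ℕ) : {c : ι → ℕ | ∑ i, c i ≤ m}.Finite := by
  refine (Set.Finite.pi' fun _ : ι => Set.finite_Iic m).subset fun c hc i => ?_
  exact (Finset.single_le_sum (f := c) (fun _ _ => Nat.zero_le _) (Finset.mem_univ i)).trans hc

theorem ncard_sum_le_of_one_le_on (I : Finset ι) (t : ℕ) :
    {c : ι → ℕ | (∀ i ∈ I, 1 ≤ c i) ∧ ∑ i, c i ≤ t}.ncard =
      (t + Fintype.card ι - I.card).choose (Fintype.card ι) := by
  classical
  have hsum : ∑ i, (if i ∈ I then 1 else 0) = I.card := by simp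
  rcases le_or_gt I.card t with h | h
  · rw [show t + Fintype.card ι - I.card = (t - I.card) + Fintype.card ι by omega, ← card_sum_le,
      ← Nat.card_coe_set_eq]
    refine Nat.card_congr
      { toFun := fun c => ⟨fun i => c.1 i - if i ∈ I then 1 else 0, ?_⟩
        invFun := fun c => ⟨fun i => c.1 i + if i ∈ I then 1 else 0, ?_, ?_⟩
        left_inv := fun c => ?_
        right_inv := fun c => ?_ }
    · have h1 : ∑ i, (c.1 i - if i ∈ I then 1 else 0) + ∑ i, (if i ∈ I then 1 else 0)
          = ∑ i, c.1 i := by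
        rw [← Finset.sum_add_distrib]
        refine Finset.sum_congr rfl fun i _ => Nat.sub_add_cancel ?_
        split_ifs with hi
        · exact c.2.1 i hi
        · exact Nat.zero_le _
      have h2 := c.2.2
      exact Nat.le_sub_of_add_le (by rw [← hsum, h1]; exact h2)
    · intro i hi
      simp [hi]
    · rw [Finset.sum_add_distrib, hsum]
      have := c.2
      omega
    · ext i
      refine Nat.sub_add_cancel ?_
      split_ifs with hi
      · exact c.2.1 i hi
      · exact Nat.zero_le _
    · ext i
      exact Nat.add_sub_cancel _ _
  · have hempty : {c : ι → ℕ | (∀ i ∈ I, 1 ≤ c i) ∧ ∑ i, c i ≤ t} = ∅ := by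
      refine Set.eq_empty_of_forall_notMem fun c hc => ?_
      have h1 : ∑ i, (if i ∈ I then 1 else 0) ≤ ∑ i, c i := by
        refine Finset.sum_le_sum fun i _ => ?_
        split_ifs with hi
        · exact hc.1 i hi
        · exact Nat.zero_le _
      have := hc.2
      omega
    -- As `I.card` is at most the number of indices, the subtraction is not truncated, and `t <
    -- I.card` makes the upper entry smaller than the lower one.
    rw [hempty, Set.ncard_empty, Nat.choose_eq_zero_of_lt]
    have := I.card_le_univ
    omega

end StarsAndBars

/-! ### Lattice points of the half-open cones -/

section LatticePoint

variable {V : Type*} [DecidableEq V] {G : SimpleGraph V} {T : Set G.Dart}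

/-- The integer combination of the edge vectors of `T` with given coefficients. -/
noncomputable def latticePoint (T : Set G.Dart) [Fintype T] (c : T → ℕ) : V → ℤ :=
  ∑ e : T, c e • (Pi.single e.1.snd 1 - Pi.single e.1.fst 1)

theorem cast_latticePoint [Fintype T] (c : T → ℕ) :
    (fun v => (latticePoint T c v : ℝ)) = ∑ e : T, (c e : ℝ) • edgeVector e.1 := by
  ext v
  simp [latticePoint, edgeVector, Finset.sum_apply, Pi.single_apply]

end LatticePoint

section Lattice

variable {V : Type*} [Fintype V] {G : SimpleGraph V} {T : Set G.Dart}

open Classical in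
theorem exists_shoreForm_eq_natCast {e : G.Dart} {z : V → ℤ}
    (h : 0 ≤ shoreForm T e fun v => (z v : ℝ)) :
    ∃ n : ℕ, shoreForm T e (fun v => (z v : ℝ)) = n := by
  have h1 : shoreForm T e (fun v => (z v : ℝ)) = ((∑ v with v ∈ headShore T e, z v : ℤ) : ℝ) := by
    rw [shoreForm_apply, Int.cast_sum]
  rw [h1] at h ⊢
  obtain ⟨n, hn⟩ := Int.eq_ofNat_of_zero_le (Int.cast_nonneg_iff.1 h)
  exact ⟨n, by rw [hn]; simp⟩

theorem internalSemiPassivity_le [LinearOrder G.Dart] : internalSemiPassivity T ≤ Nat.card T := by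
  rw [Nat.card_coe_set_eq]
  exact Set.ncard_le_ncard (fun e he => he.1) (Set.toFinite T)

variable [DecidableEq V]

open Classical in
theorem IsOrientedSpanningTree.shoreForm_latticePoint (hT : IsOrientedSpanningTree T)
    {e : G.Dart} (he : e ∈ T) (c : T → ℕ) :
    shoreForm T e (fun v => (latticePoint T c v : ℝ)) = c ⟨e, he⟩ := by
  rw [cast_latticePoint]
  exact hT.shoreForm_sum he fun e => (c e : ℝ)

open Classical in
theorem IsOrientedSpanningTree.latticePoint_injective (hT : IsOrientedSpanningTree T) :
    Function.Injective (latticePoint T) := by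
  intro c c' h
  ext ⟨e, he⟩
  have h1 := hT.shoreForm_latticePoint he c
  rw [h, hT.shoreForm_latticePoint he c'] at h1
  exact_mod_cast h1.symm

variable [LinearOrder G.Dart]

open Classical in
/-- The lattice points of height at most `t` in the half-open cone of `T`. -/
def halfOpenLatticePoints (T : Set G.Dart) (t : ℕ) : Set (V → ℤ) :=
  {z | (fun v => (z v : ℝ)) ∈ halfOpenCone T ∧
    ∑ e : T, shoreForm T e.1 (fun v => (z v : ℝ)) ≤ t}

open Classical in
-- Unimodularity: the coordinates of a lattice point are integers, so strict positivity means at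
-- least 1.
theorem IsOrientedSpanningTree.halfOpenLatticePoints_eq_image (hT : IsOrientedSpanningTree T)
    (t : ℕ) : halfOpenLatticePoints T t = latticePoint T ''
      {c | (∀ e ∈ Finset.univ.filter fun e : T => IsInternallySemiPassive T e.1, 1 ≤ c e) ∧
        ∑ e, c e ≤ t} := by
  ext z
  constructor
  · rintro ⟨hz, hzt⟩
    choose c hc using fun e : T => exists_shoreForm_eq_natCast (hz.2 e.1 e.2).1
    refine ⟨c, ⟨fun e he => ?_, ?_⟩, ?_⟩
    · have h := (hz.2 e.1 e.2).2 (Finset.mem_filter.1 he).2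
      rw [hc] at h
      exact_mod_cast h
    · simp only [hc] at hzt
      exact_mod_cast hzt
    · have h := cast_latticePoint c
      simp only [← hc] at h
      rw [hT.sum_shoreForm_smul hz.1] at h
      ext v
      exact_mod_cast congrFun h v
  · rintro ⟨c, ⟨hc1, hct⟩, rfl⟩
    refine ⟨⟨?_, fun e he => ?_⟩, ?_⟩
    · simp [cast_latticePoint]
    · rw [hT.shoreForm_latticePoint he]
      refine ⟨Nat.cast_nonneg _, fun h => ?_⟩
      have := hc1 ⟨e, he⟩ (Finset.mem_filter.2 ⟨Finset.mem_univ _, h⟩)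
      exact_mod_cast this
    · rw [Finset.sum_congr rfl fun e _ => hT.shoreForm_latticePoint e.2 c]
      exact_mod_cast hct

theorem IsOrientedSpanningTree.finite_halfOpenLatticePoints (hT : IsOrientedSpanningTree T)
    (t : ℕ) : (halfOpenLatticePoints T t).Finite := by
  classical
  rw [hT.halfOpenLatticePoints_eq_image]
  exact ((finite_sum_le t).subset fun c hc => hc.2).image _

theorem IsOrientedSpanningTree.ncard_halfOpenLatticePoints (hT : IsOrientedSpanningTree T)
    (t : ℕ) : (halfOpenLatticePoints T t).ncard =
      (t + Nat.card T - internalSemiPassivity T).choose (Nat.card T) := by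
  classical
  rw [hT.halfOpenLatticePoints_eq_image, Set.ncard_image_of_injective _ hT.latticePoint_injective,
    ncard_sum_le_of_one_le_on, Nat.card_eq_fintype_card]
  congr 2
  rw [internalSemiPassivity, ← Set.ncard_coe_finset,
    ← Set.ncard_image_of_injective _ (Subtype.val_injective (p := (· ∈ T)))]
  congr 1
  ext e
  simp only [Finset.coe_filter, Finset.mem_univ, true_and, Set.mem_image, Set.mem_ofPred_eq]
  exact ⟨fun ⟨g, hg, hge⟩ => hge ▸ hg, fun h => ⟨⟨e, h.1⟩, h, rfl⟩⟩

end Lattice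

/-! ### The Ehrhart count -/

section Ehrhart

variable {V : Type*} [Fintype V] [DecidableEq V] {G : SimpleGraph V} {T : Set G.Dart}
  {𝒯 : Set (Set G.Dart)}

theorem IsOrientedSpanningTree.polytopeDim_symmetricEdgePolytope (hT : IsOrientedSpanningTree T)
    (f : G.Dart) : polytopeDim (symmetricEdgePolytope G) = Nat.card T := by
  classical
  have h : vectorSpan ℝ (symmetricEdgePolytope G) = LinearMap.ker (coordSum V) := by
    apply le_antisymm
    · rw [vectorSpan_def, Submodule.span_le]
      rintro _ ⟨x, hx, y, hy, rfl⟩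
      simp [coordSum_eq_zero_of_mem hx, coordSum_eq_zero_of_mem hy]
    · rw [← hT.span_eq, Submodule.span_le]
      rintro _ ⟨e, rfl⟩
      simpa using vsub_mem_vectorSpan ℝ (edgeVector_mem (f := e.1)) (zero_mem_symmetricEdgePolytope f)
  rw [polytopeDim, h, ← hT.span_eq, finrank_span_eq_card hT.linearIndependent,
    Nat.card_eq_fintype_card]

open Classical in
theorem IsDissectingTreeSet.mem_smul_symmetricEdgePolytope_iff (h𝒯 : IsDissectingTreeSet 𝒯)
    (f : G.Dart) (hT : T ∈ 𝒯) {x : V → ℝ} (hx : coordSum V x = 0)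
    (hx0 : ∀ e ∈ T, 0 ≤ shoreForm T e x) (t : ℕ) :
    x ∈ (t : ℝ) • symmetricEdgePolytope G ↔ ∑ e : T, shoreForm T e.1 x ≤ t := by
  have hT' := h𝒯.isTree T hT
  -- For `t = 0` the dilate is the origin alone, and nonnegative coordinates with sum at most 0 all
  -- vanish; otherwise rescale by `t⁻¹`.
  rcases Nat.eq_zero_or_pos t with rfl | ht
  · rw [Nat.cast_zero, Set.zero_smul_set ⟨0, zero_mem_symmetricEdgePolytope f⟩, Set.mem_zero]
    constructor
    · rintro rfl
      simp
    · intro h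
      have h0 := (Finset.sum_eq_zero_iff_of_nonneg fun (e : T) _ => hx0 e.1 e.2).1
        (le_antisymm h (Finset.sum_nonneg fun e _ => hx0 e.1 e.2))
      rw [← hT'.sum_shoreForm_smul hx]
      exact Finset.sum_eq_zero fun e he => by rw [h0 e he, zero_smul]
  · have ht' : (0 : ℝ) < t := Nat.cast_pos.2 ht
    have hnn : ∀ e ∈ T, 0 ≤ shoreForm T e ((t : ℝ)⁻¹ • x) := fun e he => by
      rw [map_smul]
      exact mul_nonneg (inv_nonneg.2 ht'.le) (hx0 e he)
    have hsum : ∑ e : T, shoreForm T e.1 ((t : ℝ)⁻¹ • x) ≤ 1 ↔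
        ∑ e : T, shoreForm T e.1 x ≤ t := by
      simp only [map_smul, smul_eq_mul]
      rw [← Finset.mul_sum, inv_mul_le_iff₀ ht', mul_one]
    rw [Set.mem_smul_set_iff_inv_smul_mem₀ ht'.ne', ← hsum]
    refine ⟨fun h => h𝒯.sum_shoreForm_le hT h hnn, fun h => ?_⟩
    refine hT'.mem_symmetricEdgePolytope f (by simp [hx]) ?_
    rwa [Finset.sum_congr rfl fun (e : T) _ => abs_of_nonneg (hnn e.1 e.2)]

variable [LinearOrder G.Dart]

theorem IsDissectingTreeSet.latticePoints_eq_biUnion (h𝒯 : IsDissectingTreeSet 𝒯) (f : G.Dart)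
    (t : ℕ) : {z : V → ℤ | (fun v => (z v : ℝ)) ∈ (t : ℝ) • symmetricEdgePolytope G} =
      ⋃ T ∈ 𝒯, halfOpenLatticePoints T t := by
  ext z
  simp only [Set.mem_iUnion, exists_prop]
  constructor
  · intro hz
    have hz0 : coordSum V (fun v => (z v : ℝ)) = 0 := by
      obtain ⟨x, hx, hxz⟩ := hz
      rw [← hxz]
      simp [coordSum_eq_zero_of_mem hx]
    obtain ⟨T, hT, hzT⟩ := h𝒯.exists_mem_halfOpenCone f hz0
    exact ⟨T, hT, hzT, (h𝒯.mem_smul_symmetricEdgePolytope_iff f hT hz0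
      (fun e he => (hzT.2 e he).1) t).1 hz⟩
  · rintro ⟨T, hT, hzT, hzt⟩
    exact (h𝒯.mem_smul_symmetricEdgePolytope_iff f hT hzT.1
      (fun e he => (hzT.2 e he).1) t).2 hzt

theorem IsDissectingTreeSet.ehrhartCount_eq_sum (h𝒯 : IsDissectingTreeSet 𝒯) (f : G.Dart)
    (t : ℕ) : ehrhartCount (symmetricEdgePolytope G) t =
      ∑ T ∈ (Set.toFinite 𝒯).toFinset, (t + polytopeDim (symmetricEdgePolytope G) -
        internalSemiPassivity T).choose (polytopeDim (symmetricEdgePolytope G)) := by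
  rw [ehrhartCount, h𝒯.latticePoints_eq_biUnion f, (Set.toFinite 𝒯).ncard_biUnion
    (fun T hT => (h𝒯.isTree T hT).finite_halfOpenLatticePoints t),
    finsum_mem_eq_finite_toFinset_sum _ (Set.toFinite 𝒯)]
  · refine Finset.sum_congr rfl fun T hT => ?_
    have hT' := h𝒯.isTree T ((Set.toFinite 𝒯).mem_toFinset.1 hT)
    rw [hT'.ncard_halfOpenLatticePoints, hT'.polytopeDim_symmetricEdgePolytope f]
  · intro T hT T' hT' hne
    refine Set.disjoint_left.2 fun z hz hz' => hne ?_
    exact h𝒯.eq_of_mem_halfOpenCone f hT hT' hz.1 hz'.1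

end Ehrhart

end SymmetricEdge

theorem mainTheorem2 {V : Type*} [Fintype V] [DecidableEq V] (G : SimpleGraph V) (hG : G ≠ ⊥)
    [LinearOrder G.Dart] (𝒯 : Set (Set G.Dart)) (h𝒯 : SymmetricEdge.IsDissectingTreeSet 𝒯) :
    SymmetricEdge.IsHStarVector (SymmetricEdge.symmetricEdgePolytope G)
      (fun i : ℕ => (({T ∈ 𝒯 | SymmetricEdge.internalSemiPassivity T = i}.ncard : ℕ) : ℚ)) := by
  obtain ⟨u, v, huv⟩ := SimpleGraph.ne_bot_iff_exists_adj.1 hG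
  let f : G.Dart := ⟨(u, v), huv⟩
  have hle : ∀ T ∈ 𝒯, SymmetricEdge.internalSemiPassivity T ≤
      SymmetricEdge.polytopeDim (SymmetricEdge.symmetricEdgePolytope G) := fun T hT => by
    rw [(h𝒯.isTree T hT).polytopeDim_symmetricEdgePolytope f]
    exact SymmetricEdge.internalSemiPassivity_le
  refine ⟨fun t => ?_, fun k hk => ?_⟩
  -- Group the trees by their number of semi-passive edges, which never exceeds the dimension.
  · rw [h𝒯.ehrhartCount_eq_sum f, Nat.cast_sum, ← Finset.sum_fiberwise_of_maps_to
      (g := SymmetricEdge.internalSemiPassivity)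
      (t := Finset.range (SymmetricEdge.polytopeDim (SymmetricEdge.symmetricEdgePolytope G) + 1))]
    · refine Finset.sum_congr rfl fun k _ => ?_
      rw [Finset.sum_congr rfl fun T hT => by rw [(Finset.mem_filter.1 hT).2], Finset.sum_const,
        nsmul_eq_mul, ← Set.ncard_coe_finset]
      congr 3
      ext T
      simp
    · intro T hT
      exact Finset.mem_range.2 (Nat.lt_succ_of_le (hle T ((Set.toFinite 𝒯).mem_toFinset.1 hT)))
  · have hempty : {T ∈ 𝒯 | SymmetricEdge.internalSemiPassivity T = k} = ∅ :=
      Set.eq_empty_of_forall_notMem fun T hT => (hle T hT.1).not_gt (hT.2 ▸ hk)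
    simp only [hempty, Set.ncard_empty, Nat.cast_zero]
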